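/- Let $b_1,b_2\in\mathbb{R}^2$ be linearly independent and equip $\mathbb{R}^2$ with the polytopic norm $\|a\|_{\mathcal P}=\max_{k=1,2}|a\cdot b_k|$. Let $G=(V,E)$ be a finite simple graph with at least one vertex and let $p=(p_v)_{v\in V}$ be a placement of its vertices in $\mathbb{R}^2$. An infinitesimal flex of $(G,p)$ is a $u=(u_v)_{v\in V}\in(\mathbb{R}^2)^V$ with $\|(p_v+tu_v)-(p_w+tu_w)\|_{\mathcal P}-\|p_v-p_w\|_{\mathcal P}=o(t)$ as $t\to0$ for every edge $vw\in E$. It is trivial if there is a family of continuous paths $\gamma_x:[-1,1]\to\mathbb{R}^2$ $(x\in\mathbb{R}^2)$, each differentiable at $0$ with $\gamma_x(0)=x$, such that $\|\gamma_x(t)-\gamma_y(t)\|_{\mathcal P}=\|x-y\|_{\mathcal P}$ for all $x,y\in\mathbb{R}^2$ and $t\in[-1,1]$, and $u_v=\gamma_{p_v}'(0)$ for all $v\in V$. The framework $(G,p)$ is infinitesimally rigid if all its infinitesimal flexes are trivial, and minimally infinitesimally rigid if moreover the removal of any single edge of $G$ gives a framework that is not infinitesimally rigid. For $a\in\mathbb{R}^2$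 let $\kappa(a)=b_k$ if $k$ is the unique index with $\|a\|_{\mathcal P}=|a\cdot b_k|$, and $\kappa(a)=0$ if there is no unique such index. The rigidity matrix $R_{\mathcal P}(G,p)$ is the $|E|\times 2|V|$ matrix whose row for an edge $vw$ has $\kappa(p_v-p_w)$ in the two columns of $v$, $-\kappa(p_v-p_w)$ in the two columns of $w$, and zeros elsewhere. Suppose that $(G,p)$ is * well-positioned: for every edge $vw\in E$ there is a unique index $k\in\{1,2\}$, the framework colour of $vw$, with $\|p_v-p_w\|_{\mathcal P}=|(p_v-p_w)\cdot b_k|$; and * regular: $\operatorname{rank}R_{\mathcal P}(G,p)\ge\operatorname{rank}R_{\mathcal P}(G,p')$ for every placement $p'\in(\mathbb{R}^2)^V$. For $k=1,2$ let $G_k$ be the graph with vertex set $V$ whose edges are the edges of $G$ of framework colour $k$. Then the following are equivalent: 1. $(G,p)$ is minimally infinitesimally rigid in $(\mathbb{R}^2,\|\cdot\|_{\mathcal P})$. 2. $G_1$ and $G_2$ are edge-disjoint spanning trees of $G$. 3. $G$ is $(2,2)$-tight, that is, $|E|=2|V|-2$ and $|E(H)|\le 2|V(H)|-2$ for every subgraph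 $H$ of $G$ with at least one vertex. -/

import Mathlib

open Filter Topology Asymptotics

namespace PolytopicRigidity

noncomputable section

/-! ### Infinitesimal rigidity with respect to a norm `N` on `ℝ^d`

The norm is passed as a function `N`; since all norms on `ℝ^d` are equivalent, continuity and
differentiability of paths do not depend on it. -/

/-- `u` is an infinitesimal flex of `(G, p)`: every edge length of `(G, p + t u)` differs from that
of `(G, p)` by `o(t)` as `t → 0`. -/
def IsInfinitesimalFlex {V : Type*} {d : ℕ} (N : (Fin d → ℝ) → ℝ) (G : SimpleGraph V)
    (p u : V → Fin d → ℝ) : Prop :=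
  ∀ i j : V, G.Adj i j →
    (fun t : ℝ => N ((p i + t • u i) - (p j + t • u j)) - N (p i - p j)) =o[𝓝 0]
      (fun t : ℝ => t)

/-- A rigid motion of `(ℝ^d, N)`: a family of paths `γ x`, of which only the values on `[-1, 1]`
matter. -/
structure IsRigidMotion {d : ℕ} (N : (Fin d → ℝ) → ℝ) (γ : (Fin d → ℝ) → ℝ → (Fin d → ℝ)) :
    Prop where
  continuousOn : ∀ x, ContinuousOn (γ x) (Set.Icc (-1) 1)
  differentiableAt : ∀ x, DifferentiableAt ℝ (γ x) 0
  map_zero : ∀ x, γ x 0 = x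
  isometry : ∀ t ∈ Set.Icc (-1 : ℝ) 1, ∀ x y, N (γ x t - γ y t) = N (x - y)

/-- `u` is induced on the framework points by a rigid motion. -/
def IsTrivialFlex {V : Type*} {d : ℕ} (N : (Fin d → ℝ) → ℝ) (p u : V → Fin d → ℝ) : Prop :=
  ∃ γ : (Fin d → ℝ) → ℝ → (Fin d → ℝ), IsRigidMotion N γ ∧ ∀ i, u i = deriv (γ (p i)) 0

/-- Every infinitesimal flex is trivial. -/
def IsInfinitesimallyRigid {V : Type*} {d : ℕ} (N : (Fin d → ℝ) → ℝ) (G : SimpleGraph V)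
    (p : V → Fin d → ℝ) : Prop :=
  ∀ u : V → Fin d → ℝ, IsInfinitesimalFlex N G p u → IsTrivialFlex N p u

/-- Infinitesimally rigid, and removing any single edge destroys this. -/
def IsMinimallyInfinitesimallyRigid {V : Type*} {d : ℕ} (N : (Fin d → ℝ) → ℝ)
    (G : SimpleGraph V) (p : V → Fin d → ℝ) : Prop :=
  IsInfinitesimallyRigid N G p ∧
    ∀ e ∈ G.edgeSet, ¬ IsInfinitesimallyRigid N (G.deleteEdges {e}) p

/-! ### Polytopic norms -/

/-- The polytopic norm `‖a‖ = max_k |a · b_k|`. -/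
def polyNorm {d s : ℕ} (b : Fin s → Fin d → ℝ) (a : Fin d → ℝ) : ℝ :=
  ⨆ k, |a ⬝ᵥ b k|

/-- `k` is the unique index with `‖a‖ = |a · b_k|`. -/
def HasColour {d s : ℕ} (b : Fin s → Fin d → ℝ) (a : Fin d → ℝ) (k : Fin s) : Prop :=
  polyNorm b a = |a ⬝ᵥ b k| ∧ ∀ l, polyNorm b a = |a ⬝ᵥ b l| → l = k

open Classical in
/-- `κ(a) = b_k` if `k` is the unique index with `‖a‖ = |a · b_k|`, and `κ(a) = 0` if there is no
such unique index. -/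
def kappa {d s : ℕ} (b : Fin s → Fin d → ℝ) (a : Fin d → ℝ) : Fin d → ℝ :=
  if h : ∃ k, HasColour b a k then b h.choose else 0

open Classical in
/-- The rigidity matrix. The row of an edge `e = {i, j}` has `κ(p i - p j)` in the columns of `i`,
`-κ(p i - p j)` in the columns of `j`, and zeros elsewhere, where `(i, j)` is a chosen ordering of
the end points of `e`. The choice affects the row only by a sign. -/
def rigidityMatrix {V : Type*} {d s : ℕ} (b : Fin s → Fin d → ℝ) (G : SimpleGraph V)
    (p : V → Fin d → ℝ) : Matrix G.edgeSet (V × Fin d) ℝ :=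
  fun e x =>
    let i : V := (Quot.out e.1).1
    let j : V := (Quot.out e.1).2
    if x.1 = i then kappa b (p i - p j) x.2
    else if x.1 = j then -kappa b (p i - p j) x.2
    else 0

/-- The rank of the rigidity matrix is maximal over all realisations of `G`. -/
def IsRegular {V : Type*} [Fintype V] {d s : ℕ} (b : Fin s → Fin d → ℝ) (G : SimpleGraph V)
    (p : V → Fin d → ℝ) : Prop :=
  ∀ p' : V → Fin d → ℝ, (rigidityMatrix b G p').rank ≤ (rigidityMatrix b G p).rank

/-- Every edge has a framework colour. -/
def IsWellPositioned {V : Type*} {d s : ℕ} (b : Fin s → Fin d → ℝ) (G : SimpleGraph V)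
    (p : V → Fin d → ℝ) : Prop :=
  ∀ i j : V, G.Adj i j → ∃ k, HasColour b (p i - p j) k

theorem hasColour_sub_comm {d s : ℕ} (b : Fin s → Fin d → ℝ) (x y : Fin d → ℝ) (k : Fin s) :
    HasColour b (x - y) k ↔ HasColour b (y - x) k := by
  have h : ∀ l, |(x - y) ⬝ᵥ b l| = |(y - x) ⬝ᵥ b l| := fun l => by
    rw [← neg_sub, neg_dotProduct, abs_neg]
  simp only [HasColour, polyNorm, h]

/-- The monochrome subgraph `G_k`: all vertices, and the edges of framework colour `k`. -/
def monochrome {V : Type*} {d s : ℕ} (b : Fin s → Fin d → ℝ) (G : SimpleGraph V)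
    (p : V → Fin d → ℝ) (k : Fin s) : SimpleGraph V where
  Adj i j := G.Adj i j ∧ HasColour b (p i - p j) k
  symm := ⟨fun _ _ h => ⟨h.1.symm, (hasColour_sub_comm b _ _ k).1 h.2⟩⟩
  loopless := ⟨fun _ h => h.1.ne rfl⟩

/-! ### Sparsity -/

/-- `|E(H)| ≤ 2|V(H)| - 2` for every subgraph `H` with at least one vertex. -/
def IsTwoTwoSparse {V : Type*} (G : SimpleGraph V) : Prop :=
  ∀ H : G.Subgraph, H.verts.Nonempty →
    (H.edgeSet.ncard : ℤ) ≤ 2 * (H.verts.ncard : ℤ) - 2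

/-- `(2,2)`-sparse with `|E| = 2|V| - 2`. -/
def IsTwoTwoTight {V : Type*} (G : SimpleGraph V) : Prop :=
  IsTwoTwoSparse G ∧ (G.edgeSet.ncard : ℤ) = 2 * (Nat.card V : ℤ) - 2

end

end PolytopicRigidity

namespace PolytopicRigidity

noncomputable section

/-! ### Counting adjacent pairs -/

/-! Each edge of colour `k` constrains only the `b k`-component of a flex, and the trivial flexes
are the translations. A flex therefore splits into two scalar functions, one locally constant along
each monochrome graph, and rigidity means that both monochrome graphs are connected
(`isInfinitesimallyRigid_iff`). As every edge has exactly one colour, minimality means that both are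
trees. Counting edges of two forests inside a subgraph then gives (2,2)-tightness.

The converse is harder, since tightness is combinatorial and `p` is given. A tight graph gets some
placement with both colour classes connected. At that placement the kernel of the rigidity matrix is
just the translations, the least it can be, so a regular placement has the same kernel and connected
colour classes too (`IsRegular.connected_monochrome`). The edge count makes the classes trees.

The good placement is built in coordinates where the colours are the signs of edge slopes
(`IsSlopePlacement`), by strong induction on the number of vertices (`exists_isSlopePlacement`). The
moves are: adding a vertex with two neighbours, subdividing an edge and joining the new vertex to a
third one, and replacing a vertex by a small copy of a placed tight graph; the base cases are one
vertex and the complete graph on four. Connectivity is phrased throughout as "locally constant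
functions are constant", which is the form the kernel uses. -/

open Classical in
/-- The number of pairs `(x, y) ∈ X × Y` with `x` adjacent to `y`. -/
def adjCount {V : Type*} (G : SimpleGraph V) (X Y : Finset V) : ℕ :=
  ∑ x ∈ X, ∑ y ∈ Y, if G.Adj x y then 1 else 0

section adjCount

variable {V : Type*} (G : SimpleGraph V)

theorem adjCount_comm (X Y : Finset V) : adjCount G X Y = adjCount G Y X := by
  unfold adjCount
  rw [Finset.sum_comm]
  refine Finset.sum_congr rfl fun y _ => Finset.sum_congr rfl fun x _ => ?_
  classical exact if_congr (G.adj_comm x y) rfl rfl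

open Classical in
theorem adjCount_singleton_left (v : V) (Y : Finset V) :
    adjCount G {v} Y = (Y.filter (G.Adj v)).card := by
  rw [adjCount, Finset.sum_singleton, Finset.card_filter]

theorem adjCount_singleton_of_forall_adj {v : V} {Y : Finset V} (h : ∀ y ∈ Y, G.Adj v y) :
    adjCount G {v} Y = Y.card := by
  classical
  rw [adjCount_singleton_left, Finset.filter_true_of_mem h]

theorem adjCount_singleton_self (v : V) : adjCount G {v} {v} = 0 := by
  simp [adjCount]

variable [DecidableEq V]

theorem adjCount_union_left {X Y : Finset V} (h : Disjoint X Y) (Z : Finset V) :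
    adjCount G (X ∪ Y) Z = adjCount G X Z + adjCount G Y Z := by
  unfold adjCount
  rw [Finset.sum_union h]

theorem adjCount_union_self {X Y : Finset V} (h : Disjoint X Y) :
    adjCount G (X ∪ Y) (X ∪ Y) =
      adjCount G X X + adjCount G Y Y + 2 * adjCount G X Y := by
  rw [adjCount_union_left G h, adjCount_comm G X, adjCount_comm G Y, adjCount_union_left G h,
    adjCount_union_left G h, adjCount_comm G Y X]
  ring

theorem adjCount_insert_self {v : V} {X : Finset V} (h : v ∉ X) :
    adjCount G (insert v X) (insert v X) = adjCount G X X + 2 * adjCount G {v} X := by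
  rw [Finset.insert_eq, adjCount_union_self G (by simpa using h), adjCount_singleton_self]
  ring

/-- Ordered pairs count every edge twice. In `isSparseOn_sup_edge` this parity turns a strict
inequality into room for a whole edge. -/
theorem even_adjCount_self (X : Finset V) : Even (adjCount G X X) := by
  induction X using Finset.induction_on with
  | empty => simp [adjCount]
  | insert v X hv ih =>
    rw [adjCount_insert_self G hv]
    exact ih.add (even_two_mul _)

end adjCount

/-! ### Placements with connected colour classes -/

/-- Every function on `S` that is constant along the edges of `G` in `S` satisfying `C` is constant
on `S`. -/
def IsLinked {V : Type*} (G : SimpleGraph V) (S : Finset V) (C : V → V → Prop) : Prop :=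
  ∀ f : V → ℝ, (∀ x ∈ S, ∀ y ∈ S, G.Adj x y → C x y → f x = f y) → ∀ x ∈ S, ∀ y ∈ S, f x = f y

/-- The points `(α v, β v)`, `v ∈ S`, have distinct first and distinct second coordinates; the edges
of positive slope connect `S`, and so do the edges of negative slope. -/
structure IsSlopePlacement {V : Type*} (G : SimpleGraph V) (S : Finset V) (α β : V → ℝ) :
    Prop where
  injOn_fst : Set.InjOn α S
  injOn_snd : Set.InjOn β S
  linked_pos : IsLinked G S fun x y => 0 < (α x - α y) * (β x - β y)
  linked_neg : IsLinked G S fun x y => (α x - α y) * (β x - β y) < 0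

theorem IsSlopePlacement.neg_snd {V : Type*} {G : SimpleGraph V} {S : Finset V} {α β : V → ℝ}
    (h : IsSlopePlacement G S α β) : IsSlopePlacement G S α (fun v => -β v) := by
  have e : ∀ x y, (α x - α y) * (-β x - -β y) = -((α x - α y) * (β x - β y)) := fun x y => by ring
  refine ⟨h.injOn_fst, fun x hx y hy hxy => h.injOn_snd hx hy (neg_injective hxy), ?_, ?_⟩
  · simpa only [e, Left.neg_pos_iff] using h.linked_neg
  · simpa only [e, Left.neg_neg_iff] using h.linked_pos

theorem exists_notMem_of_isOpen {U : Set ℝ} (hU : IsOpen U) {x : ℝ} (hx : x ∈ U) {F : Set ℝ}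
    (hF : F.Finite) : ∃ y ∈ U, y ∉ F := by
  have h := ((infinite_of_mem_nhds x (hU.mem_nhds hx)).sdiff hF).nonempty
  exact ⟨h.some, h.some_mem.1, h.some_mem.2⟩

/-- A point of an open subset of the plane can be moved off finitely many vertical and horizontal
lines. -/
theorem exists_notMem_of_isOpen_prod {U : Set (ℝ × ℝ)} (hU : IsOpen U) (hne : U.Nonempty)
    {F F' : Set ℝ} (hF : F.Finite) (hF' : F'.Finite) :
    ∃ s t, (s, t) ∈ U ∧ s ∉ F ∧ t ∉ F' := by
  obtain ⟨⟨s₀, t₀⟩, h₀⟩ := hne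
  obtain ⟨s, hs, hsF⟩ := exists_notMem_of_isOpen
    (hU.preimage (f := fun s : ℝ => (s, t₀)) (by fun_prop)) h₀ hF
  obtain ⟨t, ht, htF⟩ := exists_notMem_of_isOpen
    (hU.preimage (f := fun t : ℝ => (s, t)) (by fun_prop)) hs hF'
  exact ⟨s, t, ht, hsF, htF⟩

/-- Take `s` strictly between `a` and `b`, and `t` beyond both heights on the appropriate side. -/
theorem exists_pos_neg {a a' b b' : ℝ} (h : a ≠ b) :
    ∃ s t : ℝ, 0 < (s - a) * (t - a') ∧ (s - b) * (t - b') < 0 := by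
  rcases lt_or_gt_of_ne h with h | h
  · refine ⟨(a + b) / 2, max a' b' + 1, ?_, ?_⟩
    · exact mul_pos (by linarith) (by linarith [le_max_left a' b'])
    · exact mul_neg_of_neg_of_pos (by linarith) (by linarith [le_max_right a' b'])
  · refine ⟨(a + b) / 2, min a' b' - 1, ?_, ?_⟩
    · exact mul_pos_of_neg_of_neg (by linarith) (by linarith [min_le_left a' b'])
    · exact mul_neg_of_pos_of_neg (by linarith) (by linarith [min_le_right a' b'])

/-- This places a subdividing vertex: it sees both ends of a positive edge with positive slope and
the third vertex with negative slope. The cases follow the position of `c` relative to `a` and `b`.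
-/
theorem exists_pos_pos_neg {a a' b b' c c' : ℝ} (hab : 0 < (a - b) * (a' - b')) (hac : a ≠ c)
    (hbc : b ≠ c) (hac' : a' ≠ c') :
    ∃ s t : ℝ, 0 < (s - a) * (t - a') ∧ 0 < (s - b) * (t - b') ∧ (s - c) * (t - c') < 0 := by
  wlog h : a < b generalizing a a' b b'
  · have hba : b < a := by
      rcases lt_trichotomy a b with h' | h' | h'
      · exact absurd h' h
      · simp [h'] at hab
      · exact h'
    -- Exchanging the roles of `a` and `b` needs `b' ≠ c'`, so the case of equality is settled
    -- directly.
    by_cases hbc' : b' = c'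
    · subst hbc'
      have hb' : b' < a' := by nlinarith
      rcases lt_or_gt_of_ne hbc with h1 | h1
      · refine ⟨(b + min a c) / 2, (a' + b') / 2, ?_, ?_, ?_⟩
        · exact mul_pos_of_neg_of_neg (by linarith [min_le_left a c]) (by linarith)
        · exact mul_pos (by linarith [lt_min hba h1]) (by linarith)
        · exact mul_neg_of_neg_of_pos (by linarith [min_le_right a c]) (by linarith)
      · refine ⟨(b + c) / 2, b' - 1, ?_, ?_, ?_⟩
        · exact mul_pos_of_neg_of_neg (by linarith) (by linarith)
        · exact mul_pos_of_neg_of_neg (by linarith) (by linarith)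
        · exact mul_neg_of_pos_of_neg (by linarith) (by linarith)
    · obtain ⟨s, t, h1, h2, h3⟩ := this (a := b) (a' := b') (b := a) (b' := a')
        (by nlinarith) hbc hac hbc' hba
      exact ⟨s, t, h2, h1, h3⟩
  have h' : a' < b' := by nlinarith
  rcases lt_or_gt_of_ne hac with h1 | h1
  · rcases lt_or_gt_of_ne hbc with h2 | h2
    · refine ⟨(b + c) / 2, max b' c' + 1, ?_, ?_, ?_⟩
      · exact mul_pos (by linarith) (by linarith [le_max_left b' c'])
      · exact mul_pos (by linarith) (by linarith [le_max_left b' c'])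
      · exact mul_neg_of_neg_of_pos (by linarith) (by linarith [le_max_right b' c'])
    · rcases lt_or_gt_of_ne hac' with h3 | h3
      · refine ⟨(b + c) / 2, (a' + min b' c') / 2, ?_, ?_, ?_⟩
        · exact mul_pos (by linarith) (by linarith [lt_min h' h3])
        · exact mul_pos_of_neg_of_neg (by linarith) (by linarith [min_le_left b' c'])
        · exact mul_neg_of_pos_of_neg (by linarith) (by linarith [min_le_right b' c'])
      · refine ⟨(a + c) / 2, (a' + b') / 2, ?_, ?_, ?_⟩
        · exact mul_pos (by linarith) (by linarith)
        · exact mul_pos_of_neg_of_neg (by linarith) (by linarith)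
        · exact mul_neg_of_neg_of_pos (by linarith) (by linarith)
  · refine ⟨(a + c) / 2, min a' c' - 1, ?_, ?_, ?_⟩
    · exact mul_pos_of_neg_of_neg (by linarith) (by linarith [min_le_left a' c'])
    · exact mul_pos_of_neg_of_neg (by linarith) (by linarith [min_le_left a' c'])
    · exact mul_neg_of_pos_of_neg (by linarith) (by linarith [min_le_right a' c'])

section extension

variable {V : Type*} [DecidableEq V] {G G' : SimpleGraph V} {S : Finset V} {α β : V → ℝ}

theorem injOn_update_insert {v : V} (hv : v ∉ S) (hα : Set.InjOn α S) {s : ℝ}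
    (hs : s ∉ α '' (S : Set V)) :
    Set.InjOn (Function.update α v s) (insert v S : Finset V) := by
  have e : Set.EqOn (Function.update α v s) α S := fun x hx => by
    exact Function.update_of_ne (by rintro rfl; exact hv hx) _ _
  rw [Finset.coe_insert, Set.injOn_insert (by simpa using hv)]
  refine ⟨hα.congr e.symm, ?_⟩
  rw [e.image_eq]
  simpa using hs

/-- If the functions on `insert v S` that are constant along edges of `G` are already determined on
`S` by `G'`, and `v` has a suitable neighbour in `S`, then `insert v S` is linked. -/
theorem IsLinked.insert_vertex {C C' : V → V → Prop} (h : IsLinked G' S C) {v c : V} (hc : c ∈ S)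
    (hvc : G.Adj v c) (hC : C' v c)
    (hstep : ∀ f : V → ℝ,
      (∀ x ∈ insert v S, ∀ y ∈ insert v S, G.Adj x y → C' x y → f x = f y) →
        ∀ x ∈ S, ∀ y ∈ S, G'.Adj x y → C x y → f x = f y) :
    IsLinked G (insert v S) C' := by
  intro f hf
  have h1 := h f (hstep f hf)
  have h2 : f v = f c := hf v (by simp) c (by simp [hc]) hvc hC
  have h3 : ∀ x ∈ insert v S, f x = f c := by
    intro x hx
    rcases Finset.mem_insert.1 hx with rfl | hx
    · exact h2
    · exact h1 x hx c hc
  intro x hx y hy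
  rw [h3 x hx, h3 y hy]

/-- Adding a vertex with two neighbours. -/
theorem IsSlopePlacement.exists_insert_two (h : IsSlopePlacement G S α β) {v a b : V} (hv : v ∉ S)
    (ha : a ∈ S) (hb : b ∈ S) (hab : a ≠ b) (hva : G.Adj v a) (hvb : G.Adj v b) :
    ∃ α' β', IsSlopePlacement G (insert v S) α' β' := by
  -- The new point sees `a` with positive and `b` with negative slope, so each class gains a pendant
  -- edge.
  obtain ⟨s, t, ⟨h1, h2⟩, hs, ht⟩ := exists_notMem_of_isOpen_prod
    (U := {q : ℝ × ℝ | 0 < (q.1 - α a) * (q.2 - β a) ∧ (q.1 - α b) * (q.2 - β b) < 0})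
    (by refine IsOpen.and ?_ ?_ <;> exact isOpen_lt (by fun_prop) (by fun_prop))
    (by
      obtain ⟨s, t, h⟩ := exists_pos_neg (a' := β a) (b' := β b) (h.injOn_fst.ne ha hb hab)
      exact ⟨(s, t), h⟩)
    (S.finite_toSet.image α) (S.finite_toSet.image β)
  have hne : ∀ x ∈ S, x ≠ v := fun x hx e => hv (e ▸ hx)
  refine ⟨Function.update α v s, Function.update β v t,
    injOn_update_insert hv h.injOn_fst hs, injOn_update_insert hv h.injOn_snd ht,
    h.linked_pos.insert_vertex ha hva ?_ ?_, h.linked_neg.insert_vertex hb hvb ?_ ?_⟩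
  · simpa [Function.update_of_ne (hne a ha)] using h1
  · intro f hf x hx y hy hxy hC
    refine hf x (by simp [hx]) y (by simp [hy]) hxy ?_
    simpa [Function.update_of_ne (hne x hx), Function.update_of_ne (hne y hy)] using hC
  · simpa [Function.update_of_ne (hne b hb)] using h2
  · intro f hf x hx y hy hxy hC
    refine hf x (by simp [hx]) y (by simp [hy]) hxy ?_
    simpa [Function.update_of_ne (hne x hx), Function.update_of_ne (hne y hy)] using hC

/-- Subdividing the edge `ab` by `v`, and joining `v` to a third vertex `c`. -/
theorem IsSlopePlacement.exists_insert_three (h : IsSlopePlacement G' S α β)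
    {v a b c : V} (hG' : ∀ x y, G'.Adj x y → G.Adj x y ∨ s(x, y) = s(a, b)) (hv : v ∉ S)
    (ha : a ∈ S) (hb : b ∈ S) (hc : c ∈ S) (hab : a ≠ b) (hac : a ≠ c) (hbc : b ≠ c)
    (hva : G.Adj v a) (hvb : G.Adj v b) (hvc : G.Adj v c) :
    ∃ α' β', IsSlopePlacement G (insert v S) α' β' := by
  -- Reflecting the second coordinate exchanges the two classes.
  wlog hpos : 0 < (α a - α b) * (β a - β b) generalizing β
  · have hne := mul_ne_zero (sub_ne_zero.2 (h.injOn_fst.ne ha hb hab))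
      (sub_ne_zero.2 (h.injOn_snd.ne ha hb hab))
    have hneg := lt_of_le_of_ne (not_lt.1 hpos) hne
    exact this h.neg_snd (by linarith)
  obtain ⟨s, t, ⟨h1, h2, h3⟩, hs, ht⟩ := exists_notMem_of_isOpen_prod
    (U := {q : ℝ × ℝ | 0 < (q.1 - α a) * (q.2 - β a) ∧ 0 < (q.1 - α b) * (q.2 - β b) ∧
      (q.1 - α c) * (q.2 - β c) < 0})
    (by refine IsOpen.and ?_ (IsOpen.and ?_ ?_) <;> exact isOpen_lt (by fun_prop) (by fun_prop))
    (by
      obtain ⟨s, t, h⟩ := exists_pos_pos_neg hpos (h.injOn_fst.ne ha hc hac)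
        (h.injOn_fst.ne hb hc hbc) (h.injOn_snd.ne ha hc hac)
      exact ⟨(s, t), h⟩)
    (S.finite_toSet.image α) (S.finite_toSet.image β)
  have hne : ∀ x ∈ S, x ≠ v := fun x hx e => hv (e ▸ hx)
  refine ⟨Function.update α v s, Function.update β v t,
    injOn_update_insert hv h.injOn_fst hs, injOn_update_insert hv h.injOn_snd ht,
    h.linked_pos.insert_vertex ha hva ?_ ?_, h.linked_neg.insert_vertex hc hvc ?_ ?_⟩
  · simpa [Function.update_of_ne (hne a ha)] using h1
  · intro f hf x hx y hy hxy hC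
    -- The positive path from `a` through `v` to `b` takes over the role of the edge `ab`.
    have hfa : f v = f a := hf v (by simp) a (by simp [ha]) hva
      (by simpa [Function.update_of_ne (hne a ha)] using h1)
    have hfb : f v = f b := hf v (by simp) b (by simp [hb]) hvb
      (by simpa [Function.update_of_ne (hne b hb)] using h2)
    rcases hG' x y hxy with hxy | hxy
    · refine hf x (by simp [hx]) y (by simp [hy]) hxy ?_
      simpa [Function.update_of_ne (hne x hx), Function.update_of_ne (hne y hy)] using hC
    · rcases Sym2.eq_iff.1 hxy with ⟨rfl, rfl⟩ | ⟨rfl, rfl⟩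
      · rw [← hfa, hfb]
      · rw [← hfb, hfa]
  · simpa [Function.update_of_ne (hne c hc)] using h3
  · intro f hf x hx y hy hxy hC
    rcases hG' x y hxy with hxy | hxy
    · refine hf x (by simp [hx]) y (by simp [hy]) hxy ?_
      simpa [Function.update_of_ne (hne x hx), Function.update_of_ne (hne y hy)] using hC
    -- The edge `ab` has positive slope, so the negative class does not lose it.
    · rcases Sym2.eq_iff.1 hxy with ⟨rfl, rfl⟩ | ⟨rfl, rfl⟩
      · exact absurd hC hpos.not_gt
      · exact absurd hC (by nlinarith)

end extension

/-! ### Contraction of a vertex set -/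

section contraction

variable {V : Type*} [DecidableEq V]

/-- The map that sends all of `T` to `h`. -/
def collapse (T : Finset V) (h x : V) : V := if x ∈ T then h else x

/-- The graph obtained from `G` by contracting `T` to the vertex `h`. -/
def contraction (G : SimpleGraph V) (T : Finset V) (h : V) : SimpleGraph V where
  Adj x y := x ≠ y ∧ ∃ x' y', G.Adj x' y' ∧ collapse T h x' = x ∧ collapse T h y' = y
  symm := ⟨fun _ _ ⟨hne, x', y', hadj, hx, hy⟩ => ⟨hne.symm, y', x', hadj.symm, hy, hx⟩⟩
  loopless := ⟨fun _ hx => hx.1 rfl⟩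

variable {G : SimpleGraph V} {S T : Finset V} {h : V}

theorem collapse_eq_iff_of_notMem (hh : h ∈ T) {x z : V} (hx : x ∉ T) :
    collapse T h z = x ↔ z = x := by
  unfold collapse
  split_ifs with hz
  · exact ⟨fun e => absurd (e ▸ hh) hx, fun e => absurd (e ▸ hz) hx⟩
  · rfl

theorem collapse_eq_self_iff (hh : h ∈ T) {z : V} : collapse T h z = h ↔ z ∈ T := by
  unfold collapse
  split_ifs with hz
  · simp [hz]
  · exact ⟨fun e => absurd (e ▸ hh) hz, fun e => absurd e hz⟩

theorem collapse_mem {x : V} (hx : x ∈ S) : collapse T h x ∈ insert h (S \ T) := by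
  unfold collapse
  split_ifs with hxT <;> simp [hx, hxT]

theorem mem_of_collapse_mem (hh : h ∈ T) (hTS : T ⊆ S) {x : V}
    (hx : collapse T h x ∈ insert h (S \ T)) : x ∈ S := by
  rw [Finset.mem_insert, collapse_eq_self_iff hh, Finset.mem_sdiff] at hx
  unfold collapse at hx
  split_ifs at hx with hxT
  · exact hTS hxT
  · simpa [hxT] using hx

theorem contraction_adj_of_notMem (hh : h ∈ T) {x y : V} (hx : x ∉ T) (hy : y ∉ T) :
    (contraction G T h).Adj x y ↔ G.Adj x y := by
  constructor
  · rintro ⟨-, x', y', hadj, hx', hy'⟩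
    rw [collapse_eq_iff_of_notMem hh hx] at hx'
    rw [collapse_eq_iff_of_notMem hh hy] at hy'
    rwa [← hx', ← hy']
  · exact fun hadj => ⟨hadj.ne, x, y, hadj, (collapse_eq_iff_of_notMem hh hx).2 rfl,
      (collapse_eq_iff_of_notMem hh hy).2 rfl⟩

theorem contraction_adj_left (hh : h ∈ T) {x : V} (hx : x ∉ T) :
    (contraction G T h).Adj x h ↔ ∃ t ∈ T, G.Adj x t := by
  constructor
  · rintro ⟨-, x', y', hadj, hx', hy'⟩
    rw [collapse_eq_iff_of_notMem hh hx] at hx'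
    rw [collapse_eq_self_iff hh] at hy'
    exact ⟨y', hy', hx' ▸ hadj⟩
  · rintro ⟨t, ht, hadj⟩
    exact ⟨fun e => hx (e ▸ hh), x, t, hadj, (collapse_eq_iff_of_notMem hh hx).2 rfl,
      (collapse_eq_self_iff hh).2 ht⟩

theorem adjCount_contraction_of_disjoint (hh : h ∈ T) {X : Finset V} (hXT : Disjoint X T) :
    adjCount (contraction G T h) X X = adjCount G X X := by
  classical
  have hX : ∀ x ∈ X, x ∉ T := fun x hx => Finset.disjoint_left.1 hXT hx
  refine Finset.sum_congr rfl fun x hx => Finset.sum_congr rfl fun y hy => ?_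
  exact if_congr (contraction_adj_of_notMem hh (hX x hx) (hX y hy)) rfl rfl

/-- If every vertex outside `T` has at most one neighbour in `T`, contracting `T` loses exactly the
edges inside `T`. -/
theorem adjCount_contraction (hh : h ∈ T) {X : Finset V} (hXT : Disjoint X T)
    (hdeg : ∀ x ∈ X, adjCount G {x} T ≤ 1) :
    adjCount (contraction G T h) (insert h X) (insert h X) + adjCount G T T =
      adjCount G (X ∪ T) (X ∪ T) := by
  have hX : ∀ x ∈ X, x ∉ T := fun x hx => Finset.disjoint_left.1 hXT hx
  have hhX : h ∉ X := fun hx => hX h hx hh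
  rw [adjCount_insert_self _ hhX, adjCount_union_self G hXT, adjCount_comm _ {h}]
  have h2 : adjCount (contraction G T h) X {h} = adjCount G X T := by
    classical
    refine Finset.sum_congr rfl fun x hx => ?_
    have hd := hdeg x hx
    rw [adjCount_singleton_left] at hd
    rw [Finset.sum_singleton, if_congr (contraction_adj_left hh (hX x hx)) rfl rfl,
      ← Finset.card_filter]
    split_ifs with hex
    · obtain ⟨t, ht, hadj⟩ := hex
      refine le_antisymm (Finset.card_pos.2 ⟨t, ?_⟩) ?_
      · simp [ht, hadj]
      · convert hd
    · symm
      rw [Finset.card_eq_zero, Finset.filter_eq_empty_iff]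
      exact fun t ht hadj => hex ⟨t, ht, hadj⟩
  rw [adjCount_contraction_of_disjoint hh hXT, h2]
  ring

/-- A locally constant function is constant on `T`, hence factors through `collapse`, and every edge
of the contraction lifts to an edge of `G`. -/
theorem IsLinked.of_contraction {C C' CT : V → V → Prop} (hh : h ∈ T) (hTS : T ⊆ S)
    (hT : IsLinked G T CT) (hc : IsLinked (contraction G T h) (insert h (S \ T)) C')
    (h1 : ∀ x ∈ T, ∀ y ∈ T, CT x y → C x y)
    (h2 : ∀ x ∈ S, ∀ y ∈ S, C' (collapse T h x) (collapse T h y) → C x y) :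
    IsLinked G S C := by
  intro f hf
  have hfT := hT f fun x hx y hy hadj hxy => hf x (hTS hx) y (hTS hy) hadj (h1 x hx y hy hxy)
  have hcol : ∀ x, f (collapse T h x) = f x := by
    intro x
    unfold collapse
    split_ifs with hx
    · exact hfT h hh x hx
    · rfl
  have hfc := hc f (by
    rintro x hx y hy ⟨-, x', y', hadj, rfl, rfl⟩ hxy
    have hx' := mem_of_collapse_mem hh hTS hx
    have hy' := mem_of_collapse_mem hh hTS hy
    rw [hcol, hcol]
    exact hf x' hx' y' hy' hadj (h2 x' hx' y' hy' hxy))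
  intro x hx y hy
  rw [← hcol x, ← hcol y]
  exact hfc _ (collapse_mem hx) _ (collapse_mem hy)

/-- A placement of the contracted graph is refined by a small copy of a placement of `T`. -/
theorem IsSlopePlacement.exists_of_contraction {α β α' β' : V → ℝ} (hh : h ∈ T) (hTS : T ⊆ S)
    (hT : IsSlopePlacement G T α β)
    (hc : IsSlopePlacement (contraction G T h) (insert h (S \ T)) α' β') :
    ∃ α₁ β₁, IsSlopePlacement G S α₁ β₁ := by
  -- At `ε = 0` all of `T` sits at the point of `h`; for `ε > 0` it is a copy of its own placement
  -- scaled by `ε`, which keeps the slope signs inside `T`.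
  let A : (V → ℝ) → (V → ℝ) → ℝ → V → ℝ := fun a' a ε x =>
    a' (collapse T h x) + ε * if x ∈ T then a x else 0
  have hA0 : ∀ a' a x, A a' a 0 x = a' (collapse T h x) := fun a' a x => by simp [A]
  have hAT : ∀ a' a ε, ∀ x ∈ T, ∀ y ∈ T, A a' a ε x - A a' a ε y = ε * (a x - a y) := by
    intro a' a ε x hx y hy
    simp only [A, collapse, if_pos hx, if_pos hy]
    ring
  have hAc : ∀ a' a x, Continuous fun ε => A a' a ε x := fun a' a x => by
    simp only [A]
    fun_prop
  have hpos : ∀ᶠ ε in 𝓝[>] (0 : ℝ), 0 < ε := self_mem_nhdsWithin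
  -- Finitely many open conditions true at `ε = 0` survive for all small `ε > 0`.
  have hall : ∀ P : V → V → ℝ → Prop, (∀ x y, IsOpen {ε | P x y ε}) →
      ∀ᶠ ε in 𝓝[>] (0 : ℝ), ∀ x ∈ S, ∀ y ∈ S, P x y 0 → P x y ε := by
    intro P hP
    refine (Filter.eventually_all_finset S).2 fun x _ => (Filter.eventually_all_finset S).2
      fun y _ => ?_
    by_cases h0 : P x y 0
    · filter_upwards [mem_nhdsWithin_of_mem_nhds ((hP x y).mem_nhds h0)] with ε hε _ using hε
    · exact Filter.Eventually.of_forall fun ε h => absurd h h0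
  have hne : ∀ a' a, ∀ᶠ ε in 𝓝[>] (0 : ℝ), ∀ x ∈ S, ∀ y ∈ S,
      A a' a 0 x ≠ A a' a 0 y → A a' a ε x ≠ A a' a ε y := fun a' a =>
    hall (fun x y ε => A a' a ε x ≠ A a' a ε y) fun x y => isOpen_ne_fun (hAc a' a x) (hAc a' a y)
  obtain ⟨ε, hε, hα, hβ, hp, hn⟩ := (hpos.and <| (hne α' α).and <| (hne β' β).and <|
    (hall (fun x y ε => 0 < (A α' α ε x - A α' α ε y) * (A β' β ε x - A β' β ε y)) fun x y =>
      isOpen_lt continuous_const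
        (((hAc _ _ x).sub (hAc _ _ y)).mul ((hAc _ _ x).sub (hAc _ _ y)))).and
    (hall (fun x y ε => (A α' α ε x - A α' α ε y) * (A β' β ε x - A β' β ε y) < 0) fun x y =>
      isOpen_lt (((hAc _ _ x).sub (hAc _ _ y)).mul ((hAc _ _ x).sub (hAc _ _ y)))
        continuous_const)).exists
  have hinj : ∀ a' a : V → ℝ, Set.InjOn a T → Set.InjOn a' (insert h (S \ T) : Finset V) →
      (∀ x ∈ S, ∀ y ∈ S, A a' a 0 x ≠ A a' a 0 y → A a' a ε x ≠ A a' a ε y) →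
      Set.InjOn (A a' a ε) S := by
    intro a' a ha ha' hA x hx y hy hxy
    have hcol : collapse T h x = collapse T h y := by
      by_contra hne
      refine hA x hx y hy ?_ hxy
      rw [hA0, hA0]
      exact ha'.ne (collapse_mem hx) (collapse_mem hy) hne
    by_cases hyT : y ∈ T
    · have hxT : x ∈ T := by
        rwa [← collapse_eq_self_iff hh, hcol, collapse_eq_self_iff hh]
      have := hAT a' a ε x hxT y hyT
      rw [hxy, sub_self, eq_comm, mul_eq_zero, or_iff_right hε.ne', sub_eq_zero] at this
      exact ha hxT hyT this
    · rw [(collapse_eq_iff_of_notMem hh hyT).2 rfl, collapse_eq_iff_of_notMem hh hyT] at hcol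
      exact hcol
  have hmul : ∀ x ∈ T, ∀ y ∈ T, (A α' α ε x - A α' α ε y) * (A β' β ε x - A β' β ε y) =
      ε ^ 2 * ((α x - α y) * (β x - β y)) := by
    intro x hx y hy
    rw [hAT _ _ _ x hx y hy, hAT _ _ _ x hx y hy]
    ring
  refine ⟨A α' α ε, A β' β ε, hinj _ _ hT.injOn_fst hc.injOn_fst hα,
    hinj _ _ hT.injOn_snd hc.injOn_snd hβ,
    hT.linked_pos.of_contraction hh hTS hc.linked_pos ?_ ?_,
    hT.linked_neg.of_contraction hh hTS hc.linked_neg ?_ ?_⟩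
  · intro x hx y hy hxy
    rw [hmul x hx y hy]
    positivity
  · intro x hx y hy hxy
    refine hp x hx y hy ?_
    simpa only [hA0] using hxy
  · intro x hx y hy hxy
    rw [hmul x hx y hy]
    exact mul_neg_of_pos_of_neg (by positivity) hxy
  · intro x hx y hy hxy
    refine hn x hx y hy ?_
    simpa only [hA0] using hxy

end contraction

/-! ### Tight graphs have placements -/

/-- Every nonempty `X ⊆ S` spans at most `2|X| - 2` edges. -/
def IsSparseOn {V : Type*} (G : SimpleGraph V) (S : Finset V) : Prop :=
  ∀ X ⊆ S, X.Nonempty → adjCount G X X + 4 ≤ 4 * X.card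

/-- `S` spans exactly `2|S| - 2` edges. -/
def IsTightOn {V : Type*} (G : SimpleGraph V) (S : Finset V) : Prop :=
  adjCount G S S + 4 = 4 * S.card

section tight

variable {V : Type*} {G : SimpleGraph V} {S T : Finset V}

theorem IsSparseOn.mono (h : IsSparseOn G S) (hTS : T ⊆ S) : IsSparseOn G T :=
  fun X hX => h X (hX.trans hTS)

theorem IsSlopePlacement.of_card_eq_one (hS : S.card = 1) : IsSlopePlacement G S 0 0 := by
  obtain ⟨v, rfl⟩ := Finset.card_eq_one.1 hS
  refine ⟨by simp, by simp, ?_, ?_⟩ <;>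
  · intro f _ x hx y hy
    rw [Finset.mem_singleton.1 hx, Finset.mem_singleton.1 hy]

variable [DecidableEq V]

/-- The complete graph on four vertices splits into an increasing and a decreasing path. -/
theorem exists_isSlopePlacement_of_four {v a b c : V} (hva : G.Adj v a) (hvb : G.Adj v b)
    (hvc : G.Adj v c) (hab : G.Adj a b) (hac : G.Adj a c) (hbc : G.Adj b c) :
    ∃ α β, IsSlopePlacement G {v, a, b, c} α β := by
  -- The heights from left to right are 2, 4, 1, 3. The increasing pairs form the path `a v c b` and
  -- the decreasing pairs the path `v b a c`.
  let α : V → ℝ := fun x => if x = v then 1 else if x = a then 2 else if x = b then 3 else 4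
  let β : V → ℝ := fun x => if x = v then 2 else if x = a then 4 else if x = b then 1 else 3
  have αv : α v = 1 := by simp [α]
  have αa : α a = 2 := by simp [α, hva.ne']
  have αb : α b = 3 := by simp [α, hvb.ne', hab.ne']
  have αc : α c = 4 := by simp [α, hvc.ne', hac.ne', hbc.ne']
  have βv : β v = 2 := by simp [β]
  have βa : β a = 4 := by simp [β, hva.ne']
  have βb : β b = 1 := by simp [β, hvb.ne', hab.ne']
  have βc : β c = 3 := by simp [β, hvc.ne', hac.ne', hbc.ne']
  refine ⟨α, β, ?_, ?_, ?_, ?_⟩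
  · intro x hx y hy hxy
    simp only [Finset.coe_insert, Finset.coe_singleton, Set.mem_insert_iff,
      Set.mem_singleton_iff] at hx hy
    rcases hx with rfl | rfl | rfl | rfl <;> rcases hy with rfl | rfl | rfl | rfl <;>
      first | rfl | (norm_num [αv, αa, αb, αc] at hxy)
  · intro x hx y hy hxy
    simp only [Finset.coe_insert, Finset.coe_singleton, Set.mem_insert_iff,
      Set.mem_singleton_iff] at hx hy
    rcases hx with rfl | rfl | rfl | rfl <;> rcases hy with rfl | rfl | rfl | rfl <;>
      first | rfl | (norm_num [βv, βa, βb, βc] at hxy)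
  · intro f hf
    have h1 : f v = f a := hf v (by simp) a (by simp) hva (by norm_num [αv, αa, βv, βa])
    have h2 : f v = f c := hf v (by simp) c (by simp) hvc (by norm_num [αv, αc, βv, βc])
    have h3 : f b = f c := hf b (by simp) c (by simp) hbc (by norm_num [αb, αc, βb, βc])
    have : ∀ x ∈ ({v, a, b, c} : Finset V), f x = f v := by simp [h1.symm, h3, h2.symm]
    exact fun x hx y hy => (this x hx).trans (this y hy).symm
  · intro f hf
    have h1 : f v = f b := hf v (by simp) b (by simp) hvb (by norm_num [αv, αb, βv, βb])
    have h2 : f a = f b := hf a (by simp) b (by simp) hab (by norm_num [αa, αb, βa, βb])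
    have h3 : f a = f c := hf a (by simp) c (by simp) hac (by norm_num [αa, αc, βa, βc])
    have : ∀ x ∈ ({v, a, b, c} : Finset V), f x = f v := by simp [h1, h2, ← h3]
    exact fun x hx y hy => (this x hx).trans (this y hy).symm

theorem adjCount_sup_edge {a b : V} (hab : a ≠ b) (hadj : ¬ G.Adj a b) (X : Finset V) :
    adjCount (G ⊔ SimpleGraph.edge a b) X X =
      adjCount G X X + if a ∈ X ∧ b ∈ X then 2 else 0 := by
  classical
  have hsum : ∀ u w : V, (∑ x ∈ X, ∑ y ∈ X, if x = u ∧ y = w then 1 else 0) =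
      if u ∈ X ∧ w ∈ X then 1 else 0 := by
    intro u w
    simp only [ite_and, Finset.sum_ite_irrel, Finset.sum_const_zero, Finset.sum_ite_eq']
  have hiff : ∀ x y, (G ⊔ SimpleGraph.edge a b).Adj x y ↔
      G.Adj x y ∨ (x = a ∧ y = b) ∨ (x = b ∧ y = a) := by
    intro x y
    rw [SimpleGraph.sup_adj, SimpleGraph.edge_adj]
    refine or_congr_right (and_iff_left_of_imp ?_)
    rintro (⟨rfl, rfl⟩ | ⟨rfl, rfl⟩)
    exacts [hab, hab.symm]
  have hind : adjCount (G ⊔ SimpleGraph.edge a b) X X = ∑ x ∈ X, ∑ y ∈ X,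
      ((if G.Adj x y then 1 else 0) + ((if x = a ∧ y = b then 1 else 0) +
        if x = b ∧ y = a then 1 else 0)) := by
    refine Finset.sum_congr rfl fun x _ => Finset.sum_congr rfl fun y _ => ?_
    by_cases h1 : x = a ∧ y = b
    · obtain ⟨rfl, rfl⟩ := h1
      simp [hiff, hadj, hab]
    · by_cases h2 : x = b ∧ y = a
      · obtain ⟨rfl, rfl⟩ := h2
        have hadj' : ¬ G.Adj x y := fun h => hadj h.symm
        simp [hiff, hadj', hab.symm]
      · simp [hiff, h1, h2]
  rw [hind]
  simp only [Finset.sum_add_distrib, hsum, and_comm (a := b ∈ X)]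
  rw [adjCount]
  congr 1
  split_ifs <;> rfl

/-- One more vertex raises the sparsity bound by two, and `T` already attains its bound. -/
theorem IsSparseOn.adjCount_singleton_le_two (hS : IsSparseOn G S) (hTS : T ⊆ S)
    (hT : IsTightOn G T) {v : V} (hv : v ∈ S) (hvT : v ∉ T) : adjCount G {v} T ≤ 2 := by
  have h := hS (insert v T) (Finset.insert_subset hv hTS) (by simp)
  rw [adjCount_insert_self G hvT, Finset.card_insert_of_notMem hvT] at h
  unfold IsTightOn at hT
  omega

/-- A tight set with no proper tight subset of two or more vertices has a vertex of degree three. -/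
theorem exists_adjCount_eq_three (hS : IsSparseOn G S) (hSt : IsTightOn G S) (hcard : 2 ≤ S.card)
    (hmin : ∀ T ⊂ S, 2 ≤ T.card → ¬ IsTightOn G T) :
    ∃ v ∈ S, adjCount G {v} (S.erase v) = 3 := by
  have hdeg : ∀ v ∈ S, adjCount G S S = adjCount G (S.erase v) (S.erase v) +
      2 * adjCount G {v} (S.erase v) := by
    intro v hv
    rw [← adjCount_insert_self G (Finset.notMem_erase v S), Finset.insert_erase hv]
  have hself : ∀ v ∈ S, adjCount G {v} (S.erase v) = adjCount G {v} S := by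
    intro v hv
    conv_rhs => rw [← Finset.insert_erase hv, Finset.insert_eq, adjCount_comm,
      adjCount_union_left G (by simp), adjCount_singleton_self, zero_add, adjCount_comm]
  -- The degrees sum to `4|S| - 4`, so some degree is at most three.
  have hlt : ∑ v ∈ S, adjCount G {v} S < ∑ v ∈ S, 4 := by
    have : ∑ v ∈ S, adjCount G {v} S = adjCount G S S :=
      Finset.sum_congr rfl fun v _ => by rw [adjCount, Finset.sum_singleton]
    rw [this, Finset.sum_const, smul_eq_mul]
    unfold IsTightOn at hSt
    omega
  obtain ⟨v, hv, hv4⟩ := Finset.exists_lt_of_sum_lt hlt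
  refine ⟨v, hv, ?_⟩
  rw [← hself v hv] at hv4
  have he := Finset.card_erase_of_mem hv
  have h1 := hS (S.erase v) (Finset.erase_subset v S) (Finset.card_pos.1 (by omega))
  have h2 := hdeg v hv
  -- Degree two would leave a tight proper subset, or exceed the number of other vertices when `S`
  -- has two elements. Degree below two is excluded by sparsity of `S.erase v`.
  have h3 : adjCount G {v} (S.erase v) ≠ 2 := by
    intro h2'
    by_cases hc : 2 ≤ (S.erase v).card
    · refine hmin _ (Finset.erase_ssubset hv) hc ?_
      unfold IsTightOn at hSt ⊢
      omega
    · have : adjCount G {v} (S.erase v) ≤ (S.erase v).card := by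
        classical
        rw [adjCount_singleton_left]
        exact Finset.card_filter_le _ _
      omega
  unfold IsTightOn at hSt
  omega

/-- A set containing both ends has at least two vertices, so it is not tight and has room for one
more edge. -/
theorem isSparseOn_sup_edge {a b : V} (hS : IsSparseOn G S) (hab : a ≠ b)
    (hadj : ¬ G.Adj a b) (hnt : ∀ T ⊆ S, 2 ≤ T.card → ¬ IsTightOn G T) :
    IsSparseOn (G ⊔ SimpleGraph.edge a b) S := by
  intro X hX hne
  rw [adjCount_sup_edge hab hadj]
  have h := hS X hX hne
  split_ifs with hm
  · have h2 : 2 ≤ X.card := Finset.one_lt_card.2 ⟨a, hm.1, b, hm.2, hab⟩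
    have h3 := hnt X hX h2
    unfold IsTightOn at h3
    obtain ⟨k, hk⟩ := even_adjCount_self G X
    omega
  · omega

/-- A tight sparse graph can be placed in the plane so that its edges of positive slope are
connected and its edges of negative slope are connected. -/
theorem exists_isSlopePlacement (hS : IsSparseOn G S) (hSt : IsTightOn G S) :
    ∃ α β, IsSlopePlacement G S α β := by
  induction hn : S.card using Nat.strong_induction_on generalizing G S with
  | _ n ih =>
  subst hn
  have hpos : 0 < S.card := by
    unfold IsTightOn at hSt
    omega
  rcases Nat.lt_or_ge S.card 2 with h1 | h2
  · exact ⟨0, 0, .of_card_eq_one (by omega)⟩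
  by_cases hex : ∃ T ⊂ S, 2 ≤ T.card ∧ IsTightOn G T
  -- A largest proper tight subset is chosen: a vertex with two neighbours in `T` keeps it tight
  -- when added, so it must complete `T` to `S`.
  · obtain ⟨T, ⟨hTS, hT2, hT⟩, hmax⟩ : ∃ T, (T ⊂ S ∧ 2 ≤ T.card ∧ IsTightOn G T) ∧
        ∀ T', T' ⊂ S ∧ 2 ≤ T'.card ∧ IsTightOn G T' → T'.card ≤ T.card := by
      classical
      obtain ⟨T, hT, hmax⟩ := Finset.exists_max_image
        (S.powerset.filter fun T => T ⊂ S ∧ 2 ≤ T.card ∧ IsTightOn G T) Finset.card (by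
          obtain ⟨T, h⟩ := hex
          exact ⟨T, by simp [h, h.1.subset]⟩)
      refine ⟨T, (Finset.mem_filter.1 hT).2, fun T' hT' => hmax T' ?_⟩
      simp [hT', hT'.1.subset]
    obtain ⟨α, β, hαβ⟩ := ih _ (Finset.card_lt_card hTS) (hS.mono hTS.subset) hT rfl
    by_cases hv : ∃ v ∈ S, v ∉ T ∧ adjCount G {v} T = 2
    · obtain ⟨v, hvS, hvT, hv2⟩ := hv
      have hins : insert v T = S := by
        by_contra hne
        have h3 := hmax (insert v T)
          ⟨(Finset.insert_subset hvS hTS.subset).ssubset_of_ne hne, by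
            rw [Finset.card_insert_of_notMem hvT]
            omega, by
            unfold IsTightOn at hT ⊢
            rw [adjCount_insert_self G hvT, Finset.card_insert_of_notMem hvT]
            omega⟩
        rw [Finset.card_insert_of_notMem hvT] at h3
        omega
      classical
      rw [adjCount_singleton_left] at hv2
      obtain ⟨a, b, hab, heq⟩ := Finset.card_eq_two.1 hv2
      have ha : a ∈ T.filter (G.Adj v) := by simp [heq]
      have hb : b ∈ T.filter (G.Adj v) := by simp [heq]
      rw [Finset.mem_filter] at ha hb
      rw [← hins]
      exact hαβ.exists_insert_two hvT ha.1 hb.1 hab ha.2 hb.2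
    -- With at most one neighbour in `T` for each outside vertex, contraction merges no edges, so
    -- sparsity and tightness pass to the contracted graph. It is smaller because `T` has at least
    -- two vertices.
    · have hdeg : ∀ v ∈ S \ T, adjCount G {v} T ≤ 1 := by
        intro v hv'
        rw [Finset.mem_sdiff] at hv'
        have h3 := hS.adjCount_singleton_le_two hTS.subset hT hv'.1 hv'.2
        have h4 : adjCount G {v} T ≠ 2 := fun h => hv ⟨v, hv'.1, hv'.2, h⟩
        omega
      obtain ⟨h, hh⟩ : T.Nonempty := Finset.card_pos.1 (by omega)
      have hhS : h ∉ S \ T := by simp [hh]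
      have hcard : (insert h (S \ T)).card + T.card = S.card + 1 := by
        rw [Finset.card_insert_of_notMem hhS]
        have := Finset.card_sdiff_add_card_eq_card hTS.subset
        omega
      have hcount : ∀ X ⊆ S \ T, adjCount (contraction G T h) (insert h X) (insert h X) +
          adjCount G T T = adjCount G (X ∪ T) (X ∪ T) := fun X hX =>
        adjCount_contraction hh (Finset.disjoint_of_subset_left hX Finset.sdiff_disjoint)
          fun x hx => hdeg x (hX hx)
      have hins : ∀ X ⊆ S \ T, adjCount (contraction G T h) (insert h X) (insert h X) + 4 ≤
          4 * (insert h X).card := by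
        intro X hX
        have h3 := hS (X ∪ T) (Finset.union_subset (hX.trans Finset.sdiff_subset) hTS.subset)
          ⟨h, by simp [hh]⟩
        have h4 := hcount X hX
        rw [Finset.card_union_of_disjoint
          (Finset.disjoint_of_subset_left hX Finset.sdiff_disjoint)] at h3
        rw [Finset.card_insert_of_notMem fun hm => hhS (hX hm)]
        unfold IsTightOn at hT
        omega
      obtain ⟨α', β', hαβ'⟩ := ih _ (by omega) (G := contraction G T h)
        (S := insert h (S \ T)) (by
          intro X hX hne
          by_cases hhX : h ∈ X
          · rw [← Finset.insert_erase hhX]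
            refine hins _ fun x hx => ?_
            have := hX (Finset.mem_of_mem_erase hx)
            exact (Finset.mem_insert.1 this).resolve_left (Finset.ne_of_mem_erase hx)
          · have hX' : X ⊆ S \ T := fun x hx =>
              (Finset.mem_insert.1 (hX hx)).resolve_left fun e => hhX (e ▸ hx)
            rw [adjCount_contraction_of_disjoint hh
              (Finset.disjoint_of_subset_left hX' Finset.sdiff_disjoint)]
            exact hS X (hX'.trans Finset.sdiff_subset) hne)
        (by
          have h4 := hcount _ subset_rfl
          rw [Finset.sdiff_union_of_subset hTS.subset] at h4
          unfold IsTightOn at hSt hT ⊢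
          omega) rfl
      exact hαβ.exists_of_contraction hh hTS.subset hαβ'
  · have hmin : ∀ T ⊂ S, 2 ≤ T.card → ¬ IsTightOn G T := fun T hT h2 ht => hex ⟨T, hT, h2, ht⟩
    obtain ⟨v, hv, hv3⟩ := exists_adjCount_eq_three hS hSt h2 hmin
    have hvS : v ∉ S.erase v := Finset.notMem_erase v S
    have hins := Finset.insert_erase hv
    have hcount := adjCount_insert_self G hvS
    rw [hins, hv3] at hcount
    have hce := Finset.card_erase_of_mem hv
    -- Removing `v` loses three edges and adding `ab` restores one, which keeps the graph tight on
    -- one vertex fewer.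
    have hstep : ∀ a ∈ S.erase v, ∀ b ∈ S.erase v, ∀ c ∈ S.erase v, a ≠ b → a ≠ c → b ≠ c →
        G.Adj v a → G.Adj v b → G.Adj v c → ¬ G.Adj a b → ∃ α β, IsSlopePlacement G S α β := by
      intro a ha b hb c hc hab hac hbc hva hvb hvc hadj
      obtain ⟨α, β, h⟩ := ih _ (Finset.card_lt_card (Finset.erase_ssubset hv))
        (isSparseOn_sup_edge (hS.mono (Finset.erase_subset v S)) hab hadj
          fun T hT => hmin T (hT.trans_ssubset (Finset.erase_ssubset hv)))
        (by
          unfold IsTightOn at hSt ⊢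
          rw [adjCount_sup_edge hab hadj, if_pos ⟨ha, hb⟩]
          omega) rfl
      rw [← hins]
      refine h.exists_insert_three (fun x y hxy => ?_) hvS ha hb hc hab hac hbc hva hvb hvc
      rw [SimpleGraph.sup_adj, SimpleGraph.edge_adj] at hxy
      exact hxy.imp_right fun h => Sym2.eq_iff.2 h.1
    classical
    rw [adjCount_singleton_left] at hv3
    obtain ⟨a, b, c, hab, hac, hbc, heq⟩ := Finset.card_eq_three.1 hv3
    have hmem : ∀ x, x ∈ ({a, b, c} : Finset V) ↔ x ∈ S.erase v ∧ G.Adj v x := by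
      intro x
      rw [← heq, Finset.mem_filter]
    obtain ⟨ha, hva⟩ := (hmem a).1 (by simp)
    obtain ⟨hb, hvb⟩ := (hmem b).1 (by simp)
    obtain ⟨hc, hvc⟩ := (hmem c).1 (by simp)
    by_cases habG : G.Adj a b
    swap
    · exact hstep a ha b hb c hc hab hac hbc hva hvb hvc habG
    by_cases hacG : G.Adj a c
    swap
    · exact hstep a ha c hc b hb hac hab hbc.symm hva hvc hvb hacG
    by_cases hbcG : G.Adj b c
    swap
    · exact hstep b hb c hc a ha hbc hab.symm hac.symm hvb hvc hva hbcG
    -- A complete graph on four vertices has six edges, so it is tight and cannot be a proper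
    -- subset.
    have hK : ({v, a, b, c} : Finset V) = S := by
      by_contra hne
      have hsub : ({v, a, b, c} : Finset V) ⊆ S := by
        intro x hx
        simp only [Finset.mem_insert, Finset.mem_singleton] at hx
        rcases hx with rfl | rfl | rfl | rfl
        exacts [hv, Finset.mem_of_mem_erase ha, Finset.mem_of_mem_erase hb,
          Finset.mem_of_mem_erase hc]
      have h4 : ({v, a, b, c} : Finset V).card = 4 := by
        simp [Finset.card_insert_of_notMem, hva.ne, hvb.ne, hvc.ne, hab, hac, hbc]
      refine hmin _ (hsub.ssubset_of_ne hne) (by omega) ?_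
      unfold IsTightOn
      rw [h4, adjCount_insert_self G (by simp [hva.ne, hvb.ne, hvc.ne]),
        adjCount_insert_self G (by simp [hab, hac]), adjCount_insert_self G (by simp [hbc]),
        adjCount_singleton_self]
      rw [adjCount_singleton_of_forall_adj G (by simp [hbcG]),
        adjCount_singleton_of_forall_adj G (by simp [habG, hacG]),
        adjCount_singleton_of_forall_adj G (by simp [hva, hvb, hvc])]
      simp [hab, hac, hbc]
    rw [← hK]
    exact exists_isSlopePlacement_of_four hva hvb hvc habG hacG hbcG

end tight

/-! ### Framework colours -/

section colour

variable {d s : ℕ}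

theorem hasColour_iff (b : Fin s → Fin d → ℝ) (a : Fin d → ℝ) (k : Fin s) :
    HasColour b a k ↔ ∀ l, l ≠ k → |a ⬝ᵥ b l| < |a ⬝ᵥ b k| := by
  have hle : ∀ l, |a ⬝ᵥ b l| ≤ polyNorm b a := fun l =>
    le_ciSup (f := fun l => |a ⬝ᵥ b l|) (Set.finite_range _).bddAbove l
  constructor
  · rintro ⟨h1, h2⟩ l hl
    rw [← h1]
    exact (hle l).lt_of_ne fun e => hl (h2 l e.symm)
  · intro h
    have h1 : polyNorm b a = |a ⬝ᵥ b k| := by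
      have : Nonempty (Fin s) := ⟨k⟩
      refine le_antisymm (ciSup_le fun l => ?_) (hle k)
      rcases eq_or_ne l k with rfl | hl
      · exact le_rfl
      · exact (h l hl).le
    refine ⟨h1, fun l hl => ?_⟩
    by_contra hne
    exact (h l hne).ne (hl.symm.trans h1)

theorem HasColour.unique {b : Fin s → Fin d → ℝ} {a : Fin d → ℝ} {k l : Fin s}
    (hk : HasColour b a k) (hl : HasColour b a l) : l = k :=
  hk.2 l hl.1

theorem kappa_eq {b : Fin s → Fin d → ℝ} {a : Fin d → ℝ} {k : Fin s} (h : HasColour b a k) :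
    kappa b a = b k := by
  have hex : ∃ k, HasColour b a k := ⟨k, h⟩
  rw [kappa, dif_pos hex, h.unique hex.choose_spec]

theorem kappa_eq_zero {b : Fin s → Fin d → ℝ} {a : Fin d → ℝ} (h : ¬ ∃ k, HasColour b a k) :
    kappa b a = 0 := by
  rw [kappa, dif_neg h]

theorem HasColour.dotProduct_ne_zero {b : Fin 2 → Fin d → ℝ} {a : Fin d → ℝ} {k : Fin 2}
    (h : HasColour b a k) : a ⬝ᵥ b k ≠ 0 := by
  obtain ⟨l, hl⟩ := exists_ne k
  exact abs_pos.1 ((abs_nonneg _).trans_lt ((hasColour_iff b a k).1 h l hl))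

/-- Along a path whose starting vector has colour `k`, the norm is locally `±` the `k`-th
functional. -/
theorem HasColour.exists_eventually_polyNorm_eq {b : Fin 2 → Fin d → ℝ} {c : ℝ → Fin d → ℝ}
    {k : Fin 2} (hc : ContinuousAt c 0) (h : HasColour b (c 0) k) :
    ∃ σ : ℝ, σ ≠ 0 ∧ ∀ᶠ t in 𝓝 0, polyNorm b (c t) = σ * (c t ⬝ᵥ b k) := by
  have hcont : ∀ l, ContinuousAt (fun t => c t ⬝ᵥ b l) 0 := fun l => by
    have : Continuous fun a : Fin d → ℝ => a ⬝ᵥ b l := by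
      unfold dotProduct
      fun_prop
    exact this.continuousAt.comp hc
  have hcol : ∀ᶠ t in 𝓝 0, HasColour b (c t) k := by
    simp only [hasColour_iff, Filter.eventually_all]
    exact fun l hl => (hcont l).abs.eventually_lt (hcont k).abs ((hasColour_iff _ _ _).1 h l hl)
  rcases lt_or_gt_of_ne h.dotProduct_ne_zero with h0 | h0
  · refine ⟨-1, by norm_num, ?_⟩
    filter_upwards [hcol, (hcont k).eventually_lt continuousAt_const h0] with t h1 h2
    rw [h1.1, abs_of_neg h2, neg_one_mul]
  · refine ⟨1, one_ne_zero, ?_⟩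
    filter_upwards [hcol, continuousAt_const.eventually_lt (hcont k) h0] with t h1 h2
    rw [h1.1, abs_of_pos h2, one_mul]

theorem hasDerivAt_dotProduct {c : ℝ → Fin d → ℝ} {c' : Fin d → ℝ} {t : ℝ}
    (h : HasDerivAt c c' t) (w : Fin d → ℝ) :
    HasDerivAt (fun t => c t ⬝ᵥ w) (c' ⬝ᵥ w) t :=
  HasDerivAt.fun_sum fun i _ => (hasDerivAt_pi.1 h i).mul_const (w i)

/-- The norm along a path starting at a vector of colour `k` is constant to first order only if the
velocity is annihilated by `b k`. -/
theorem HasColour.dotProduct_eq_zero {b : Fin 2 → Fin d → ℝ} {c : ℝ → Fin d → ℝ} {c' : Fin d → ℝ}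
    {k : Fin 2} (hc : HasDerivAt c c' 0) (h : HasColour b (c 0) k)
    (ho : (fun t => polyNorm b (c t) - polyNorm b (c 0)) =o[𝓝 0] fun t : ℝ => t) :
    c' ⬝ᵥ b k = 0 := by
  obtain ⟨σ, hσ, heq⟩ := h.exists_eventually_polyNorm_eq hc.continuousAt
  have h1 : HasDerivAt (fun t => σ * (c t ⬝ᵥ b k)) (σ * (c' ⬝ᵥ b k)) 0 :=
    (hasDerivAt_dotProduct hc _).const_mul σ
  have h2 : HasDerivAt (fun t => σ * (c t ⬝ᵥ b k)) 0 0 := by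
    rw [hasDerivAt_iff_isLittleO]
    simp only [sub_zero, smul_zero]
    refine ho.congr' ?_ EventuallyEq.rfl
    filter_upwards [heq] with t ht
    rw [ht, heq.self_of_nhds]
  exact (mul_eq_zero.1 (h1.unique h2)).resolve_left hσ

/-- A linear path starting at a vector of colour `k`. -/
theorem HasColour.isLittleO_iff {b : Fin 2 → Fin d → ℝ} {a w : Fin d → ℝ} {k : Fin 2}
    (h : HasColour b a k) :
    ((fun t : ℝ => polyNorm b (a + t • w) - polyNorm b a) =o[𝓝 0] fun t : ℝ => t) ↔
      w ⬝ᵥ b k = 0 := by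
  have hc : HasDerivAt (fun t : ℝ => a + t • w) w 0 := by
    simpa using ((hasDerivAt_id (0 : ℝ)).smul_const w).const_add a
  have h' : HasColour b ((fun t : ℝ => a + t • w) 0) k := by simpa using h
  constructor
  · intro ho
    exact h'.dotProduct_eq_zero hc (by simpa using ho)
  · intro hw
    obtain ⟨σ, hσ, heq⟩ := h'.exists_eventually_polyNorm_eq hc.continuousAt
    refine (isLittleO_zero _ _).congr' ?_ EventuallyEq.rfl
    have h0 := heq.self_of_nhds
    filter_upwards [heq] with t ht
    rw [ht]
    simp only [zero_smul, add_zero] at h0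
    rw [h0, add_dotProduct, smul_dotProduct, hw]
    simp

end colour

/-! ### Coordinates given by a basis of functionals -/

section coordinates

variable {d : ℕ} {b : Fin d → Fin d → ℝ}

theorem exists_dotProduct_eq (hb : LinearIndependent ℝ b) (c : Fin d → ℝ) :
    ∃ a : Fin d → ℝ, ∀ k, a ⬝ᵥ b k = c k := by
  have hu : IsUnit (Matrix.of b) := Matrix.linearIndependent_rows_iff_isUnit.1 hb
  obtain ⟨a, ha⟩ := Matrix.mulVec_surjective_iff_isUnit.2 hu c
  exact ⟨a, fun k => by rw [dotProduct_comm, ← ha]; rfl⟩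

theorem eq_of_forall_dotProduct_eq (hb : LinearIndependent ℝ b) {x y : Fin d → ℝ}
    (h : ∀ k, x ⬝ᵥ b k = y ⬝ᵥ b k) : x = y := by
  have hu : IsUnit (Matrix.of b) := Matrix.linearIndependent_rows_iff_isUnit.1 hb
  refine Matrix.mulVec_injective_iff_isUnit.2 hu (funext fun k => ?_)
  have := h k
  rwa [dotProduct_comm, dotProduct_comm y] at this

end coordinates

/-! ### Trivial flexes and infinitesimal rigidity -/

section rigidity

variable {V : Type*} {b : Fin 2 → Fin 2 → ℝ} {G : SimpleGraph V} {p u : V → Fin 2 → ℝ}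

theorem IsRigidMotion.deriv_dotProduct_eq {γ : (Fin 2 → ℝ) → ℝ → (Fin 2 → ℝ)}
    (hγ : IsRigidMotion (polyNorm b) γ) {x y : Fin 2 → ℝ} {k : Fin 2}
    (h : HasColour b (x - y) k) : deriv (γ x) 0 ⬝ᵥ b k = deriv (γ y) 0 ⬝ᵥ b k := by
  rw [← sub_eq_zero, ← sub_dotProduct]
  have hc := (hγ.differentiableAt x).hasDerivAt.sub (hγ.differentiableAt y).hasDerivAt
  refine HasColour.dotProduct_eq_zero hc (b := b) ?_ ?_
  · simpa [hγ.map_zero] using h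
  · refine (isLittleO_zero _ _).congr' ?_ EventuallyEq.rfl
    filter_upwards [Icc_mem_nhds (show (-1 : ℝ) < 0 by norm_num) one_pos] with t ht
    simp only [Pi.sub_apply, hγ.map_zero, hγ.isometry t ht, sub_self]

/-- For each `k`, both points are compared with a point `z` so far out in the direction dual to `b
k` that `z - x` and `z - y` have colour `k`. All components of the velocities then agree. -/
theorem IsRigidMotion.deriv_eq (hb : LinearIndependent ℝ b)
    {γ : (Fin 2 → ℝ) → ℝ → (Fin 2 → ℝ)} (hγ : IsRigidMotion (polyNorm b) γ) (x y : Fin 2 → ℝ) :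
    deriv (γ x) 0 = deriv (γ y) 0 := by
  refine eq_of_forall_dotProduct_eq hb fun k => ?_
  obtain ⟨l, hlk⟩ := exists_ne k
  obtain ⟨z, hz⟩ := exists_dotProduct_eq hb fun j =>
    if j = k then |x ⬝ᵥ b k| + |x ⬝ᵥ b l| + (|y ⬝ᵥ b k| + |y ⬝ᵥ b l|) + 1 else 0
  have hzk : z ⬝ᵥ b k = _ := (hz k).trans (if_pos rfl)
  have hzl : z ⬝ᵥ b l = 0 := (hz l).trans (if_neg hlk)
  have hfar : ∀ w : Fin 2 → ℝ, |w ⬝ᵥ b k| + |w ⬝ᵥ b l| < z ⬝ᵥ b k → HasColour b (z - w) k := by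
    intro w hw
    rw [hasColour_iff]
    intro j hj
    obtain rfl : j = l := by omega
    rw [sub_dotProduct, sub_dotProduct, hzl, zero_sub, abs_neg]
    refine lt_of_lt_of_le ?_ (le_abs_self _)
    linarith [le_abs_self (w ⬝ᵥ b k)]
  rw [← hγ.deriv_dotProduct_eq (hfar x _), ← hγ.deriv_dotProduct_eq (hfar y _)]
  · rw [hzk]
    linarith [abs_nonneg (x ⬝ᵥ b k), abs_nonneg (x ⬝ᵥ b l)]
  · rw [hzk]
    linarith [abs_nonneg (y ⬝ᵥ b k), abs_nonneg (y ⬝ᵥ b l)]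

/-- The trivial flexes are the translations. -/
theorem isTrivialFlex_iff (hb : LinearIndependent ℝ b) :
    IsTrivialFlex (polyNorm b) p u ↔ ∃ w, ∀ i, u i = w := by
  constructor
  · rintro ⟨γ, hγ, hu⟩
    exact ⟨deriv (γ 0) 0, fun i => (hu i).trans (hγ.deriv_eq hb _ _)⟩
  · rintro ⟨w, hw⟩
    have hd : ∀ x : Fin 2 → ℝ, HasDerivAt (fun t : ℝ => x + t • w) w 0 := fun x => by
      simpa using ((hasDerivAt_id (0 : ℝ)).smul_const w).const_add x
    refine ⟨fun x t => x + t • w, ⟨fun x => ?_, fun x => (hd x).differentiableAt, fun x => ?_,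
      fun t _ x y => ?_⟩, fun i => ?_⟩
    · fun_prop
    · simp
    · rw [add_sub_add_right_eq_sub]
    · rw [hw, (hd _).deriv]

theorem isInfinitesimalFlex_iff (hwp : IsWellPositioned b G p) :
    IsInfinitesimalFlex (polyNorm b) G p u ↔
      ∀ k i j, (monochrome b G p k).Adj i j → u i ⬝ᵥ b k = u j ⬝ᵥ b k := by
  have e : ∀ i j (t : ℝ), (p i + t • u i) - (p j + t • u j) = (p i - p j) + t • (u i - u j) :=
    fun i j t => by rw [smul_sub]; abel
  simp only [IsInfinitesimalFlex, e]
  constructor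
  · rintro h k i j ⟨hij, hk⟩
    have := hk.isLittleO_iff.1 (h i j hij)
    rwa [sub_dotProduct, sub_eq_zero] at this
  · intro h i j hij
    obtain ⟨k, hk⟩ := hwp i j hij
    rw [hk.isLittleO_iff, sub_dotProduct, sub_eq_zero]
    exact h k i j ⟨hij, hk⟩

/-- For the converse direction, the test function is the indicator of the component of `x`. -/
theorem connected_iff_forall_const [Nonempty V] {K : SimpleGraph V} :
    K.Connected ↔ ∀ f : V → ℝ, (∀ x y, K.Adj x y → f x = f y) → ∀ x y, f x = f y := by
  constructor
  · intro hK f hf x y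
    obtain ⟨w⟩ := hK.preconnected x y
    induction w with
    | nil => rfl
    | cons h _ ih => exact (hf _ _ h).trans ih
  · intro h
    refine ⟨fun x y => ?_⟩
    classical
    have := h (fun z => if K.Reachable x z then 1 else 0) (fun z z' hz =>
      if_congr ⟨fun r => r.trans hz.reachable, fun r => r.trans hz.symm.reachable⟩ rfl rfl) x y
    by_contra hxy
    simp [hxy] at this

/-- By independence of `b`, the two components of a flex can be prescribed separately, so a
nonconstant locally constant function on one monochrome graph yields a nontrivial flex. -/
theorem isInfinitesimallyRigid_iff [Nonempty V] (hb : LinearIndependent ℝ b)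
    (hwp : IsWellPositioned b G p) :
    IsInfinitesimallyRigid (polyNorm b) G p ↔ ∀ k, (monochrome b G p k).Connected := by
  simp only [IsInfinitesimallyRigid, isTrivialFlex_iff hb, isInfinitesimalFlex_iff hwp]
  constructor
  · intro h k
    rw [connected_iff_forall_const]
    intro f hf x y
    choose u hu using fun i => exists_dotProduct_eq hb fun j => if j = k then f i else 0
    have huk : ∀ i, u i ⬝ᵥ b k = f i := fun i => (hu i k).trans (if_pos rfl)
    obtain ⟨w, hw⟩ := h u (by
      intro l i j hij
      rw [hu, hu]
      split_ifs with hl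
      · exact hf i j (hl ▸ hij)
      · rfl)
    rw [← huk, ← huk, hw x, hw y]
  · intro h u hu
    obtain ⟨v⟩ := ‹Nonempty V›
    exact ⟨u v, fun i => eq_of_forall_dotProduct_eq hb fun k =>
      connected_iff_forall_const.1 (h k) (fun i => u i ⬝ᵥ b k) (hu k) i v⟩

theorem monochrome_deleteEdges (s : Set (Sym2 V)) (k : Fin 2) :
    monochrome b (G.deleteEdges s) p k = (monochrome b G p k).deleteEdges s := by
  ext i j
  simp only [monochrome, SimpleGraph.deleteEdges_adj]
  tauto

theorem IsWellPositioned.mono {G' : SimpleGraph V} (hwp : IsWellPositioned b G p) (h : G' ≤ G) :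
    IsWellPositioned b G' p :=
  fun i j hij => hwp i j (h hij)

theorem disjoint_edgeSet_monochrome {k l : Fin 2} (hkl : k ≠ l) :
    Disjoint (monochrome b G p k).edgeSet (monochrome b G p l).edgeSet := by
  rw [SimpleGraph.disjoint_edgeSet, disjoint_iff_inf_le]
  intro i j hij
  exact hkl (hij.2.2.unique hij.1.2)

/-- Deleting an edge alters only the monochrome graph of its own colour, so minimality says that
every edge is a bridge there. -/
theorem isMinimallyInfinitesimallyRigid_iff [Nonempty V] (hb : LinearIndependent ℝ b)
    (hwp : IsWellPositioned b G p) :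
    IsMinimallyInfinitesimallyRigid (polyNorm b) G p ↔ ∀ k, (monochrome b G p k).IsTree := by
  have hdel : ∀ e, IsInfinitesimallyRigid (polyNorm b) (G.deleteEdges {e}) p ↔
      ∀ k, ((monochrome b G p k).deleteEdges {e}).Connected := fun e => by
    rw [isInfinitesimallyRigid_iff hb (hwp.mono (G.deleteEdges_le _))]
    simp only [monochrome_deleteEdges]
  simp only [IsMinimallyInfinitesimallyRigid, isInfinitesimallyRigid_iff hb hwp, hdel]
  constructor
  · rintro ⟨hconn, hmin⟩ k
    refine ⟨hconn k, SimpleGraph.isAcyclic_iff_forall_adj_isBridge.2 fun i j hij => ?_⟩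
    by_contra hbr
    refine hmin s(i, j) hij.1 fun l => ?_
    by_cases hl : l = k
    · subst hl
      exact (hconn l).connected_delete_edge_of_not_isBridge hbr
    · have hnot : Disjoint (monochrome b G p l).edgeSet {s(i, j)} := by
        rw [Set.disjoint_singleton_right]
        exact fun h => Set.disjoint_left.1 (disjoint_edgeSet_monochrome hl) h hij
      rw [SimpleGraph.deleteEdges_eq_self.2 hnot]
      exact hconn l
  · intro h
    refine ⟨fun k => (h k).connected, fun e he hconn => ?_⟩
    induction e with | _ i j
    obtain ⟨k, hk⟩ := hwp i j he
    have hle := (SimpleGraph.isTree_iff_minimal_connected.1 (h k)).le_of_le (hconn k)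
      (SimpleGraph.deleteEdges_le _)
    have hij : (monochrome b G p k).Adj i j := ⟨he, hk⟩
    simpa using hle hij

end rigidity

/-! ### Kernel of the rigidity matrix -/

section kernel

variable {V : Type*} [Fintype V] {b : Fin 2 → Fin 2 → ℝ} {G : SimpleGraph V}

theorem adj_out {V : Type*} {G : SimpleGraph V} (e : G.edgeSet) : G.Adj (Quot.out e.1).1 (Quot.out e.1).2 := by
  have h : s((Quot.out e.1).1, (Quot.out e.1).2) = e.1 := Quot.out_eq e.1
  rw [← SimpleGraph.mem_edgeSet, h]
  exact e.2

theorem rigidityMatrix_mulVec (p : V → Fin 2 → ℝ) (u : V × Fin 2 → ℝ) (e : G.edgeSet) :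
    (rigidityMatrix b G p).mulVec u e =
      kappa b (p (Quot.out e.1).1 - p (Quot.out e.1).2) ⬝ᵥ
        ((fun k => u ((Quot.out e.1).1, k)) - fun k => u ((Quot.out e.1).2, k)) := by
  classical
  have hne := (adj_out e).ne
  simp only [rigidityMatrix, Matrix.mulVec, dotProduct, Pi.sub_apply, mul_sub,
    Finset.sum_sub_distrib]
  generalize (Quot.out e.1).1 = i at hne ⊢
  generalize (Quot.out e.1).2 = j at hne ⊢
  have hsplit : ∀ x : V × Fin 2, (if x.1 = i then kappa b (p i - p j) x.2
      else if x.1 = j then -kappa b (p i - p j) x.2 else 0) * u x =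
      (if x.1 = i then kappa b (p i - p j) x.2 * u x else 0) -
        if x.1 = j then kappa b (p i - p j) x.2 * u x else 0 := by
    intro x
    by_cases hi : x.1 = i
    · simp [hi, hne]
    · by_cases hj : x.1 = j
      · simp [hj, hne.symm]
      · simp [hi, hj]
  rw [Finset.sum_congr rfl fun x _ => hsplit x, Finset.sum_sub_distrib]
  simp [Fintype.sum_prod_type, Finset.sum_ite_irrel]

theorem mem_ker_rigidityMatrix_iff (p : V → Fin 2 → ℝ) (u : V × Fin 2 → ℝ) :
    u ∈ LinearMap.ker (rigidityMatrix b G p).mulVecLin ↔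
      ∀ k i j, (monochrome b G p k).Adj i j →
        (fun l => u (i, l)) ⬝ᵥ b k = (fun l => u (j, l)) ⬝ᵥ b k := by
  rw [LinearMap.mem_ker, Matrix.mulVecLin_apply, funext_iff]
  simp only [rigidityMatrix_mulVec, Pi.zero_apply]
  constructor
  · rintro h k i j ⟨hij, hk⟩
    have he := h ⟨s(i, j), hij⟩
    have hout : s((Quot.out s(i, j)).1, (Quot.out s(i, j)).2) = s(i, j) := Quot.out_eq _
    simp only at he
    rcases Sym2.eq_iff.1 hout with ⟨h1, h2⟩ | ⟨h1, h2⟩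
    · rw [h1, h2, kappa_eq hk, dotProduct_comm, sub_dotProduct, sub_eq_zero] at he
      exact he
    · rw [h1, h2, kappa_eq ((hasColour_sub_comm b _ _ k).1 hk), dotProduct_comm, sub_dotProduct,
        sub_eq_zero] at he
      exact he.symm
  · intro h e
    by_cases hex : ∃ k, HasColour b (p (Quot.out e.1).1 - p (Quot.out e.1).2) k
    · obtain ⟨k, hk⟩ := hex
      rw [kappa_eq hk, dotProduct_comm, sub_dotProduct, sub_eq_zero]
      exact h k _ _ ⟨adj_out e, hk⟩
    · rw [kappa_eq_zero hex, zero_dotProduct]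

/-- If some placement of `G` has connected colour classes, then so has every regular one. -/
theorem IsRegular.connected_monochrome [Nonempty V] (hb : LinearIndependent ℝ b)
    {p p' : V → Fin 2 → ℝ} (hreg : IsRegular b G p)
    (hp' : ∀ k, (monochrome b G p' k).Connected) (k : Fin 2) : (monochrome b G p k).Connected := by
  have hconst : ∀ u ∈ LinearMap.ker (rigidityMatrix b G p').mulVecLin, ∀ i j l,
      u (i, l) = u (j, l) := by
    intro u hu i j l
    rw [mem_ker_rigidityMatrix_iff] at hu
    have : (fun l => u (i, l)) = fun l => u (j, l) := eq_of_forall_dotProduct_eq hb fun k =>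
      connected_iff_forall_const.1 (hp' k) (fun i => (fun l => u (i, l)) ⬝ᵥ b k) (hu k) i j
    exact congrFun this l
  -- Translations lie in every kernel, so the kernel at `p'` is contained in the one at `p`.
  -- Regularity and rank-nullity give the opposite inequality of dimensions.
  have hker : LinearMap.ker (rigidityMatrix b G p').mulVecLin =
      LinearMap.ker (rigidityMatrix b G p).mulVecLin := by
    refine Submodule.eq_of_le_of_finrank_le (fun u hu => ?_) ?_
    · rw [mem_ker_rigidityMatrix_iff]
      intro k i j _
      congr 1
      exact funext fun l => hconst u hu i j l
    · have h1 := (rigidityMatrix b G p).mulVecLin.finrank_range_add_finrank_ker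
      have h2 := (rigidityMatrix b G p').mulVecLin.finrank_range_add_finrank_ker
      have h3 := hreg p'
      unfold Matrix.rank at h3
      omega
  rw [connected_iff_forall_const]
  intro f hf x y
  choose u hu using fun i => exists_dotProduct_eq hb fun j => if j = k then f i else 0
  have huk : ∀ i, u i ⬝ᵥ b k = f i := fun i => (hu i k).trans (if_pos rfl)
  have hmem : (fun q : V × Fin 2 => u q.1 q.2) ∈
      LinearMap.ker (rigidityMatrix b G p).mulVecLin := by
    rw [mem_ker_rigidityMatrix_iff]
    intro l i j hij
    change u i ⬝ᵥ b l = u j ⬝ᵥ b l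
    rw [hu, hu]
    split_ifs with hl
    · exact hf i j (hl ▸ hij)
    · rfl
  rw [← hker] at hmem
  rw [← huk, ← huk]
  congr 1
  exact funext fun l => hconst _ hmem x y l

end kernel

/-! ### Edge counts -/

section edgeCount

variable {V : Type*}

theorem two_mul_ncard_edgeSet [Fintype V] (K : SimpleGraph V) :
    2 * K.edgeSet.ncard = adjCount K Finset.univ Finset.univ := by
  classical
  rw [← Nat.card_coe_set_eq, Nat.card_eq_fintype_card, SimpleGraph.card_edgeSet,
    ← K.sum_degrees_eq_twice_card_edges]
  refine Finset.sum_congr rfl fun v _ => ?_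
  rw [← SimpleGraph.card_neighborFinset_eq_degree, SimpleGraph.neighborFinset_eq_filter,
    Finset.card_filter]

theorem two_mul_ncard_edgeSet_induce [Fintype V] (G : SimpleGraph V) (X : Finset V) :
    2 * ((⊤ : G.Subgraph).induce (X : Set V)).edgeSet.ncard = adjCount G X X := by
  classical
  rw [← SimpleGraph.Subgraph.edgeSet_spanningCoe, two_mul_ncard_edgeSet]
  unfold adjCount
  rw [← Finset.sum_subset (Finset.subset_univ X)]
  · refine Finset.sum_congr rfl fun x hx => ?_
    rw [← Finset.sum_subset (Finset.subset_univ X)]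
    · refine Finset.sum_congr rfl fun y hy => if_congr ?_ rfl rfl
      simp [hx, hy]
    · intro y _ hy
      simp [hy]
  · intro x _ hx
    simp [hx]

theorem IsTwoTwoTight.isSparseOn [Fintype V] {G : SimpleGraph V} (h : IsTwoTwoTight G) :
    IsSparseOn G Finset.univ := by
  intro X _ hX
  have h1 := h.1 ((⊤ : G.Subgraph).induce (X : Set V)) (by simpa using hX)
  have h2 := two_mul_ncard_edgeSet_induce G X
  rw [SimpleGraph.Subgraph.induce_verts, Set.ncard_coe_finset] at h1
  omega

theorem IsTwoTwoTight.isTightOn [Fintype V] {G : SimpleGraph V} (h : IsTwoTwoTight G) :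
    IsTightOn G Finset.univ := by
  have h1 := h.2
  have h2 := two_mul_ncard_edgeSet G
  rw [Nat.card_eq_fintype_card] at h1
  unfold IsTightOn
  rw [Finset.card_univ]
  omega

/-- A forest extends to a spanning tree of the complete graph. -/
theorem card_edgeSet_add_one_le_of_isAcyclic {W : Type*} [Finite W] [Nonempty W]
    {K : SimpleGraph W} (hK : K.IsAcyclic) : K.edgeSet.ncard + 1 ≤ Nat.card W := by
  obtain ⟨F, hKF, -, hF⟩ := SimpleGraph.connected_top.exists_isTree_le_of_le_of_isAcyclic le_top hK
  rw [← (SimpleGraph.isTree_iff_connected_and_card.1 hF).2, Nat.card_coe_set_eq]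
  exact Nat.add_le_add_right
    (Set.ncard_le_ncard (SimpleGraph.edgeSet_mono hKF) (Set.toFinite _)) 1

/-- A subgraph has at most `|V(H)| - 1` edges in common with a forest. -/
theorem ncard_edgeSet_inter_add_one_le [Finite V] {G F : SimpleGraph V} (hF : F.IsAcyclic)
    (H : G.Subgraph) (hH : H.verts.Nonempty) :
    (H.edgeSet ∩ F.edgeSet).ncard + 1 ≤ H.verts.ncard := by
  have : Nonempty H.verts := hH.to_subtype
  have h1 := card_edgeSet_add_one_le_of_isAcyclic
    ((hF.induce H.verts).anti (inf_le_right : H.coe ⊓ F.induce H.verts ≤ F.induce H.verts))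
  rw [Nat.card_coe_set_eq] at h1
  refine le_trans (Nat.add_le_add_right ?_ 1) h1
  refine le_trans (Set.ncard_le_ncard ?_ (Set.toFinite _))
    (Set.ncard_image_le (f := Sym2.map Subtype.val) (Set.toFinite _))
  intro e
  induction e with | _ x y
  rintro ⟨h1, h2⟩
  rw [SimpleGraph.Subgraph.mem_edgeSet] at h1
  exact ⟨s(⟨x, H.edge_vert h1⟩, ⟨y, H.edge_vert h1.symm⟩), ⟨h1, h2⟩, rfl⟩

variable {b : Fin 2 → Fin 2 → ℝ} {G : SimpleGraph V} {p : V → Fin 2 → ℝ}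

theorem edgeSet_eq_union_monochrome (hwp : IsWellPositioned b G p) :
    G.edgeSet = (monochrome b G p 0).edgeSet ∪ (monochrome b G p 1).edgeSet := by
  ext e
  induction e with | _ i j
  constructor
  · intro h
    obtain ⟨k, hk⟩ := hwp i j h
    fin_cases k
    · exact Or.inl ⟨h, hk⟩
    · exact Or.inr ⟨h, hk⟩
  · rintro (h | h) <;> exact h.1

variable [Fintype V]

theorem ncard_edgeSet_eq_add_monochrome (hwp : IsWellPositioned b G p) :
    G.edgeSet.ncard =
      (monochrome b G p 0).edgeSet.ncard + (monochrome b G p 1).edgeSet.ncard := by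
  rw [edgeSet_eq_union_monochrome hwp, Set.ncard_union_eq
    (disjoint_edgeSet_monochrome (by decide)) (Set.toFinite _) (Set.toFinite _)]

theorem isTwoTwoTight_of_isTree (hwp : IsWellPositioned b G p)
    (h : ∀ k, (monochrome b G p k).IsTree) : IsTwoTwoTight G := by
  constructor
  · intro H hH
    have h0 := ncard_edgeSet_inter_add_one_le (h 0).isAcyclic H hH
    have h1 := ncard_edgeSet_inter_add_one_le (h 1).isAcyclic H hH
    have h2 : H.edgeSet = (H.edgeSet ∩ (monochrome b G p 0).edgeSet) ∪
        (H.edgeSet ∩ (monochrome b G p 1).edgeSet) := by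
      rw [← Set.inter_union_distrib_left, ← edgeSet_eq_union_monochrome hwp,
        Set.inter_eq_left.2 H.edgeSet_subset]
    have h3 := Set.ncard_union_le (H.edgeSet ∩ (monochrome b G p 0).edgeSet)
      (H.edgeSet ∩ (monochrome b G p 1).edgeSet)
    rw [← h2] at h3
    omega
  · have h0 := (SimpleGraph.isTree_iff_connected_and_card.1 (h 0)).2
    have h1 := (SimpleGraph.isTree_iff_connected_and_card.1 (h 1)).2
    rw [Nat.card_coe_set_eq] at h0 h1
    have := ncard_edgeSet_eq_add_monochrome hwp
    omega

/-- Each connected class has at least `|V| - 1` edges and together they have `2|V| - 2`, so both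
bounds are attained. -/
theorem isTree_of_isTwoTwoTight (hwp : IsWellPositioned b G p)
    (hG : IsTwoTwoTight G) (h : ∀ k, (monochrome b G p k).Connected) (k : Fin 2) :
    (monochrome b G p k).IsTree := by
  rw [SimpleGraph.isTree_iff_connected_and_card]
  refine ⟨h k, ?_⟩
  have h0 := (h 0).card_vert_le_card_edgeSet_add_one
  have h1 := (h 1).card_vert_le_card_edgeSet_add_one
  rw [Nat.card_coe_set_eq] at h0 h1 ⊢
  have h2 := ncard_edgeSet_eq_add_monochrome hwp
  have h3 := hG.2
  fin_cases k <;> simp only [Fin.zero_eta, Fin.mk_one] <;> omega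

/-- In the coordinates `(α + β, α - β)`, the framework colour of an edge is the sign of its slope
with respect to `(α, β)`. -/
theorem IsSlopePlacement.exists_connected_monochrome [Nonempty V] (hb : LinearIndependent ℝ b)
    {α β : V → ℝ} (h : IsSlopePlacement G Finset.univ α β) :
    ∃ p : V → Fin 2 → ℝ, ∀ k, (monochrome b G p k).Connected := by
  choose p hp using fun v => exists_dotProduct_eq hb ![α v + β v, α v - β v]
  have hp0 : ∀ v, p v ⬝ᵥ b 0 = α v + β v := fun v => hp v 0
  have hp1 : ∀ v, p v ⬝ᵥ b 1 = α v - β v := fun v => hp v 1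
  refine ⟨p, fun k => connected_iff_forall_const.2 fun f hf x y => ?_⟩
  fin_cases k
  · refine h.linked_pos f (fun x _ y _ hadj hxy => hf x y ⟨hadj, ?_⟩) x (Finset.mem_univ x) y
      (Finset.mem_univ y)
    rw [hasColour_iff]
    intro l hl
    obtain rfl : l = 1 := Fin.eq_one_of_ne_zero l hl
    -- The squares of the two functionals on an edge differ by four times the product of its
    -- coordinate differences in `α` and `β`.
    rw [← sq_lt_sq]
    simp only [Fin.zero_eta, sub_dotProduct, hp0, hp1]
    nlinarith
  · refine h.linked_neg f (fun x _ y _ hadj hxy => hf x y ⟨hadj, ?_⟩) x (Finset.mem_univ x) y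
      (Finset.mem_univ y)
    rw [hasColour_iff]
    intro l hl
    obtain rfl : l = 0 := by
      by_contra h0
      exact hl (Fin.eq_one_of_ne_zero l h0)
    rw [← sq_lt_sq]
    simp only [Fin.mk_one, sub_dotProduct, hp0, hp1]
    nlinarith

end edgeCount

end

end PolytopicRigidity

open PolytopicRigidity in
theorem theorem4p10 {V : Type*} [Fintype V] [Nonempty V]
    (b : Fin 2 → Fin 2 → ℝ) (hb : LinearIndependent ℝ b)
    (G : SimpleGraph V) (p : V → Fin 2 → ℝ)
    (hwp : IsWellPositioned b G p) (hreg : IsRegular b G p) :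
    List.TFAE
      [IsMinimallyInfinitesimallyRigid (polyNorm b) G p,
       (monochrome b G p 0).IsTree ∧ (monochrome b G p 1).IsTree ∧
         Disjoint (monochrome b G p 0).edgeSet (monochrome b G p 1).edgeSet,
       IsTwoTwoTight G] := by
  have htree : ((monochrome b G p 0).IsTree ∧ (monochrome b G p 1).IsTree ∧
      Disjoint (monochrome b G p 0).edgeSet (monochrome b G p 1).edgeSet) ↔
      ∀ k, (monochrome b G p k).IsTree := by
    rw [Fin.forall_fin_two]
    exact ⟨fun h => ⟨h.1, h.2.1⟩,
      fun h => ⟨h.1, h.2, disjoint_edgeSet_monochrome (by decide)⟩⟩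
  rw [htree]
  tfae_have 1 ↔ 2 := isMinimallyInfinitesimallyRigid_iff hb hwp
  tfae_have 2 → 3 := isTwoTwoTight_of_isTree hwp
  tfae_have 3 → 2 := by
    intro hG
    classical
    obtain ⟨α, β, h⟩ := exists_isSlopePlacement hG.isSparseOn hG.isTightOn
    obtain ⟨p', hp'⟩ := h.exists_connected_monochrome hb
    exact isTree_of_isTwoTwoTight hwp hG fun k => hreg.connected_monochrome hb hp' k
  tfae_finish
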